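/- Let $\mathcal M$ be a matroid on $[n]=\{1,\dots,n\}$ (loops and parallel elements allowed), $\mathbb K$ a field, $\beta_{i,j}\in\mathbb K^*$ for $i<j$, and let $\mathcal A$ be the graded $\mathbb K$-algebra generated by $e_1,\dots,e_n$ with $e_i^2=0$ and $e_je_i=\beta_{i,j}e_ie_j$ for $i<j$. For $X=\{i_1<\dots<i_m\}\subseteq[n]$ put $e_X=e_{i_1}\cdots e_{i_m}$ ($e_\emptyset=1$), and for $\sigma\in S_m$ let $X^\sigma=(i_{\sigma(1)},\dots,i_{\sigma(m)})$. Given $\chi:2^{[n]}\to\mathbb K$, put $\chi(X^\sigma)=\operatorname{sgn}(\sigma)\chi(X)$ and $\partial e_X=\sum_{p=1}^m(-1)^p\chi(X\setminus i_p)\,e_{X\setminus i_p}$ for $X\neq\emptyset$, except that $\partial e_i=1$. A set is unidependent if it contains exactly one circuit. Assume: (1) $\chi(X)\ne0$ iff $X$ is independent; (2) for unidependent $U'\subseteq U$ there is $\varepsilon\in\mathbb K^*$ with $\partial e_U=\varepsilon\,(\partial e_{U'})\,e_{U\setminus U'}$. Let $\mathbb A_\chi(\mathcal M)$ be the graded quotient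 of $\mathcal A$ by the right ideal generated by the $\partial e_C$, $C$ a circuit with $|C|>1$, and the $e_i$, $i$ a loop; $\mathbb A_\ell$ is its degree $\ell$ part, and the class of $e_X$ is again denoted $e_X$. For a nonloop $x$ let $\chi_{\mathcal M/x}(X)=\chi(X\circ x)$ for $X\subseteq[n]\setminus x$, where $X\circ x$ is the increasing sequence of $X$ followed by $x$. Then $\chi_{\mathcal M/x}$ satisfies (1) and (2) for $\mathcal M/x$, and $\mathfrak p_x:\mathbb A_\chi(\mathcal M)\to\mathbb A_{\chi_{\mathcal M/x}}(\mathcal M/x)$ denotes the linear map determined on independent sets $I$ by: $\mathfrak p_x(e_I)=e_{I\setminus x}$ if $x\in I$; $\mathfrak p_x(e_I)=\frac{\chi((I\setminus y)\circ x)}{\chi((I\setminus y)\circ y)}\,e_{I\setminus y}$ if some $y\in I$ is parallel to $x$; and $\mathfrak p_x(e_I)=0$ otherwise. For an independent set $I=\{i_1<\dots<i_\ell\}$ and $\sigma\in S_\ell$ the iterated residue is the linear form $\mathfrak p_{I^\sigma}=\mathfrak p_{i_{\sigma(1)}}\circ\mathfrak p_{i_{\sigma(2)}}\circ\cdots\circ\mathfrak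 p_{i_{\sigma(\ell)}}:\mathbb A_\ell\to\mathbb K$, where the elements are contracted successively, $i_{\sigma(\ell)}$ first, and the degree $0$ part of the last algebra is identified with $\mathbb K$. Let $\mathrm{Flag}(I^\sigma)$ be the flag of flats $\mathrm{cl}(\{i_{\sigma(\ell)}\})\subsetneq\mathrm{cl}(\{i_{\sigma(\ell)},i_{\sigma(\ell-1)}\})\subsetneq\cdots\subsetneq\mathrm{cl}(\{i_{\sigma(\ell)},\dots,i_{\sigma(1)}\})$. **Proposition.** Let $I$ be an independent set of size $\ell$ and $\sigma\in S_\ell$. For every independent set $J$ of size $\ell$, $\mathfrak p_{I^\sigma}(e_J)\ne0$ if and only if there is a unique permutation $\tau\in S_\ell$ with $\mathrm{Flag}(J^\tau)=\mathrm{Flag}(I^\sigma)$. Whenever $\tau\in S_\ell$ satisfies $\mathrm{Flag}(J^\tau)=\mathrm{Flag}(I^\sigma)$, one has $\mathfrak p_{I^\sigma}(e_J)=\chi(I^\sigma)/\chi(J^\tau)$. In particular $\mathfrak p_{I^\sigma}(e_I)=1$. -/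

import Mathlib

noncomputable section

namespace ChiAlgebra

open Finset
open scoped Matroid

set_option linter.unusedSectionVars false

variable {α K : Type*} [LinearOrder α] [Field K]

/-- The graded algebra generated over `K` by `e_i`, `i ∈ α`, with `e_i ^ 2 = 0` and
`e_j * e_i = β i j • (e_i * e_j)` for `i < j`, realised on its basis of monomials
`e_X = e_{i_1} ⋯ e_{i_m}`, `X = {i_1 < ⋯ < i_m}`. Only the values `β i j` with `i < j` matter. -/
def SqZero (_β : α → α → Kˣ) : Type _ := Finset α →₀ K

namespace SqZero

variable (β : α → α → Kˣ)

instance : AddCommGroup (SqZero β) := inferInstanceAs (AddCommGroup (Finset α →₀ K))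
instance : Module K (SqZero β) := inferInstanceAs (Module K (Finset α →₀ K))

/-- The monomials `e_X` as a basis. -/
def basis : Module.Basis (Finset α) K (SqZero β) := Finsupp.basisSingleOne

/-- The monomial `e_X`. -/
def mon (X : Finset α) : SqZero β := basis β X

/-- The scalar `β_{X,Y}` in `e_X * e_Y = β_{X,Y} • e_{X ∪ Y}` for disjoint `X` and `Y`. -/
def coeff (X Y : Finset α) : K := ∏ i ∈ X, ∏ j ∈ Y, if j < i then (β j i : K) else 1

/-- Multiplication: `e_X * e_Y = β_{X,Y} • e_{X ∪ Y}` if `X ∩ Y = ∅`, and `0` otherwise. -/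
def mulHom : SqZero β →ₗ[K] SqZero β →ₗ[K] SqZero β :=
  (basis β).constr K fun X => (basis β).constr K fun Y =>
    if Disjoint X Y then coeff β X Y • mon β (X ∪ Y) else 0

instance : Mul (SqZero β) := ⟨fun a b => mulHom β a b⟩
instance : One (SqZero β) := ⟨mon β ∅⟩

lemma mul_def (a b : SqZero β) : a * b = mulHom β a b := rfl
lemma one_def : (1 : SqZero β) = mon β ∅ := rfl

lemma mon_mul_mon (X Y : Finset α) :
    mon β X * mon β Y = if Disjoint X Y then coeff β X Y • mon β (X ∪ Y) else 0 := by
  simp [mul_def, mulHom, mon]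

lemma coeff_ne_zero (X Y : Finset α) : coeff β X Y ≠ 0 := by
  unfold coeff
  refine prod_ne_zero_iff.2 fun i _ => prod_ne_zero_iff.2 fun j _ => ?_
  split_ifs <;> simp

lemma coeff_union_left {X Y : Finset α} (h : Disjoint X Y) (Z : Finset α) :
    coeff β (X ∪ Y) Z = coeff β X Z * coeff β Y Z := by
  simp [coeff, prod_union h]

lemma coeff_union_right (X : Finset α) {Y Z : Finset α} (h : Disjoint Y Z) :
    coeff β X (Y ∪ Z) = coeff β X Y * coeff β X Z := by
  simp [coeff, prod_union h, prod_mul_distrib]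

lemma hom_ext {V : Type*} [AddCommMonoid V] [Module K V] {f g : SqZero β →ₗ[K] V}
    (h : ∀ X, f (mon β X) = g (mon β X)) : f = g := (basis β).ext h

@[elab_as_elim]
lemma induction_mon {p : SqZero β → Prop} (a : SqZero β) (zero : p 0)
    (add : ∀ a b, p a → p b → p (a + b)) (smul : ∀ (c : K) a, p a → p (c • a))
    (mon : ∀ X, p (mon β X)) : p a := by
  have h : a ∈ Submodule.span K (Set.range (basis β)) := by simp [(basis β).span_eq]
  induction h using Submodule.span_induction with
  | mem x hx => obtain ⟨X, rfl⟩ := hx; exact mon X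
  | zero => exact zero
  | add x y _ _ hx hy => exact add x y hx hy
  | smul c x _ hx => exact smul c x hx

lemma mon_mul_assoc (X Y Z : Finset α) :
    mon β X * mon β Y * mon β Z = mon β X * (mon β Y * mon β Z) := by
  have hs (c : K) (a b : SqZero β) : c • a * b = c • (a * b) := by simp [mul_def]
  have hs' (c : K) (a b : SqZero β) : a * c • b = c • (a * b) := by simp [mul_def]
  have h0 (a : SqZero β) : 0 * a = 0 := by simp [mul_def]
  have h0' (a : SqZero β) : a * 0 = 0 := by simp [mul_def]
  rw [mon_mul_mon, mon_mul_mon]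
  by_cases h1 : Disjoint X Y <;> by_cases h2 : Disjoint Y Z <;>
    by_cases h3 : Disjoint X Z <;>
    simp [h1, h2, h3, hs, hs', h0, h0', mon_mul_mon, smul_smul, coeff_union_left,
      coeff_union_right, union_assoc, disjoint_union_left, disjoint_union_right]
  ring_nf

instance : Ring (SqZero β) where
  __ := (inferInstance : AddCommGroup (SqZero β))
  mul := (· * ·)
  one := 1
  left_distrib a b c := by simp [mul_def]
  right_distrib a b c := by simp [mul_def]
  zero_mul a := by simp [mul_def]
  mul_zero a := by simp [mul_def]
  mul_assoc a b c := by
    induction a using induction_mon with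
    | zero => simp [mul_def]
    | add x y hx hy => simp only [mul_def, map_add, LinearMap.add_apply] at hx hy ⊢; rw [hx, hy]
    | smul r x hx => simp only [mul_def, map_smul, LinearMap.smul_apply] at hx ⊢; rw [hx]
    | mon X =>
    induction b using induction_mon with
    | zero => simp [mul_def]
    | add x y hx hy => simp only [mul_def, map_add, LinearMap.add_apply] at hx hy ⊢; rw [hx, hy]
    | smul r x hx => simp only [mul_def, map_smul, LinearMap.smul_apply] at hx ⊢; rw [hx]
    | mon Y =>
    induction c using induction_mon with
    | zero => simp [mul_def]
    | add x y hx hy => simp only [mul_def, map_add] at hx hy ⊢; rw [hx, hy]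
    | smul r x hx => simp only [mul_def, map_smul] at hx ⊢; rw [hx]
    | mon Z => exact mon_mul_assoc β X Y Z
  one_mul a := by
    have : mulHom β (mon β ∅) = LinearMap.id := hom_ext β fun X => by
      rw [← mul_def, mon_mul_mon]; simp [coeff]
    exact DFunLike.congr_fun this a
  mul_one a := by
    have : (mulHom β).flip (mon β ∅) = LinearMap.id := hom_ext β fun X => by
      rw [LinearMap.flip_apply, ← mul_def, mon_mul_mon]; simp [coeff]
    exact DFunLike.congr_fun this a

instance : Algebra K (SqZero β) :=
  Algebra.ofModule (fun c a b => by simp [mul_def]) (fun c a b => by simp [mul_def])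

/-- The generator `e_i`. -/
def gen (i : α) : SqZero β := mon β {i}

lemma gen_mul_self (i : α) : gen β i * gen β i = 0 := by
  simp [gen, mon_mul_mon]

lemma gen_mul_gen {i j : α} (h : i < j) :
    gen β j * gen β i = (β i j : K) • (gen β i * gen β j) := by
  simp [gen, mon_mul_mon, h.ne, h.ne', coeff, h, h.not_gt, pair_comm]

/-- `e_X` is the product of the generators `e_i`, `i ∈ X`, in increasing order. -/
lemma mon_eq_prod (X : Finset α) : mon β X = ((X.sort (· ≤ ·)).map (gen β)).prod := by
  induction X using Finset.induction_on_min with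
  | empty => simp [one_def]
  | insert a s ha ih =>
    have hn : a ∉ s := fun h => lt_irrefl _ (ha a h)
    rw [Finset.sort_insert (r := (· ≤ ·)) (fun b hb => (ha b hb).le) hn, List.map_cons,
      List.prod_cons, ← ih, gen, mon_mul_mon, if_pos (by simpa using hn)]
    have : coeff β {a} s = 1 := by
      simp only [coeff, prod_singleton]
      exact prod_eq_one fun j hj => if_neg (ha j hj).not_gt
    rw [this, one_smul]; rfl

end SqZero

/-! ### Ordered sets and the map `χ` -/

/-- The value of `χ` on the ordered set `(f 0, …, f (m-1))`: the sign of the ordering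
(one factor `-1` for every inversion) times the value on the underlying set. -/
def chiOrd (χ : Finset α → K) {m : ℕ} (f : Fin m → α) : K :=
  (∏ j, ∏ i ∈ Iio j, if f i < f j then (1 : K) else -1) * χ (univ.image f)

/-- The ordered set `X^σ = (i_{σ(1)}, …, i_{σ(m)})` for `X = {i_1 < ⋯ < i_m}`. -/
def ordering (X : Finset α) {m : ℕ} (hX : X.card = m) (σ : Equiv.Perm (Fin m)) : Fin m → α :=
  X.orderEmbOfFin hX ∘ σ

/-- `χ (X^σ) = sgn(σ) χ(X)`. -/
lemma chiOrd_ordering (χ : Finset α → K) (X : Finset α) {m : ℕ} (hX : X.card = m)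
    (σ : Equiv.Perm (Fin m)) :
    chiOrd χ (ordering X hX σ) = ((Equiv.Perm.sign σ : ℤ) : K) * χ X := by
  have h1 : univ.image (ordering X hX σ) = X := by
    ext x
    have : x ∈ X ↔ ∃ i, X.orderEmbOfFin hX i = x := by
      rw [← Set.mem_range, range_orderEmbOfFin, mem_coe]
    simp only [mem_image, mem_univ, true_and, ordering, Function.comp, this]
    exact ⟨fun ⟨i, hi⟩ => ⟨_, hi⟩, fun ⟨i, hi⟩ => ⟨σ.symm i, by simpa using hi⟩⟩
  rw [chiOrd, h1, Equiv.Perm.sign_eq_prod_prod_Iio]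
  congr 1
  simp [ordering, apply_ite]

/-- `χ_{M/x}(X) = χ(X ∘ x)`, where `X ∘ x` is `X` in increasing order followed by `x`. -/
def contractChi (χ : Finset α → K) (x : α) (X : Finset α) : K :=
  chiOrd χ (Fin.snoc (X.orderEmbOfFin rfl) x : Fin (X.card + 1) → α)

lemma contractChi_eq (χ : Finset α → K) {x : α} {X : Finset α} (hx : x ∉ X) :
    contractChi χ x X = (-1) ^ (X.filter (x < ·)).card * χ (insert x X) := by
  have h1 : univ.image (Fin.snoc (X.orderEmbOfFin rfl) x : Fin (X.card + 1) → α) =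
      insert x X := by
    ext y
    have : y ∈ X ↔ ∃ i, X.orderEmbOfFin rfl i = y := by
      rw [← Set.mem_range, range_orderEmbOfFin, mem_coe]
    simp only [mem_image, mem_univ, true_and, mem_insert, this, Fin.exists_fin_succ']
    simp [Fin.snoc_castSucc, Fin.snoc_last, or_comm, eq_comm]
  rw [contractChi, chiOrd, h1, Fin.prod_univ_castSucc]
  congr 1
  have h2 (j : Fin X.card) : (∏ i ∈ Iio j.castSucc,
      if (Fin.snoc (X.orderEmbOfFin rfl) x : Fin (X.card + 1) → α) i <
        (Fin.snoc (X.orderEmbOfFin rfl) x : Fin (X.card + 1) → α) j.castSucc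
      then (1 : K) else -1) = 1 := by
    refine prod_eq_one fun i hi => if_pos ?_
    rw [mem_Iio] at hi
    obtain ⟨i, rfl⟩ := Fin.exists_castSucc_eq.2 (hi.trans_le (Fin.le_last _)).ne
    simpa [Fin.snoc_castSucc] using hi
  rw [prod_congr rfl fun j _ => h2 j, prod_const_one, one_mul]
  have h3 : (Iio (Fin.last X.card)) = univ.map Fin.castSuccEmb := by
    ext i; simp [Fin.exists_castSucc_eq]
  rw [h3, prod_map]
  simp only [Fin.coe_castSuccEmb, Fin.snoc_castSucc, Fin.snoc_last]
  have h4 : (univ : Finset (Fin X.card)).map (X.orderEmbOfFin rfl).toEmbedding = X := by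
    simp
  conv_rhs => rw [← h4]
  rw [filter_map, card_map, prod_ite, prod_const_one, one_mul, prod_const]
  congr 2
  ext i
  have : X.orderEmbOfFin rfl i ≠ x := fun h => hx (h ▸ X.orderEmbOfFin_mem rfl i)
  simp [this.symm.le_iff_lt]

/-! ### `χ`-algebras -/

/-- The `χ`-boundary `∂ e_X = ∑_p (-1)^p χ(X \ i_p) e_{X \ i_p}` of a monomial, with the
convention `∂ e_i = 1`; the position `p` of `i = i_p` is the number of `j ∈ X` with `j ≤ i`. -/
def boundary (β : α → α → Kˣ) (χ : Finset α → K) (X : Finset α) : SqZero β :=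
  if X.card = 1 then 1 else
    ∑ i ∈ X, ((-1) ^ (X.filter (· ≤ i)).card * χ (X.erase i)) • SqZero.mon β (X.erase i)

/-- `U` contains a unique circuit. -/
def IsUnidependent (M : Matroid α) (U : Finset α) : Prop :=
  (U : Set α) ⊆ M.E ∧ ∃! C : Finset α, M.IsCircuit (C : Set α) ∧ C ⊆ U

/-- The two axioms on `χ` for which `A_χ(M)` is called a `χ`-algebra. -/
structure IsChi (β : α → α → Kˣ) (M : Matroid α) (χ : Finset α → K) : Prop where
  ne_zero_iff : ∀ X : Finset α, (X : Set α) ⊆ M.E → (χ X ≠ 0 ↔ M.Indep (X : Set α))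
  boundary_eq : ∀ U U' : Finset α, IsUnidependent M U → IsUnidependent M U' → U' ⊆ U →
    ∃ ε : Kˣ, boundary β χ U = (ε : K) • (boundary β χ U' * SqZero.mon β (U \ U'))

/-- Generators of the defining ideal: the boundaries of circuits with more than one element, and
the `e_i` for loops `i`. Elements outside the ground set (which only arise by contraction) are
not generators of the algebra of `M`, so the corresponding `e_i` are killed as well. -/
def idealGens (β : α → α → Kˣ) (M : Matroid α) (χ : Finset α → K) : Set (SqZero β) :=
  {a | ∃ C : Finset α, M.IsCircuit (C : Set α) ∧ 1 < C.card ∧ a = boundary β χ C} ∪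
  {a | ∃ i, (M.IsLoop i ∨ i ∉ M.E) ∧ a = SqZero.gen β i}

/-- The right ideal generated by `idealGens`, as a subspace. -/
def chiIdeal (β : α → α → Kˣ) (M : Matroid α) (χ : Finset α → K) : Submodule K (SqZero β) :=
  Submodule.span K {a | ∃ g ∈ idealGens β M χ, ∃ b, a = g * b}

/-- The vector space underlying `A_χ(M)`. -/
abbrev ChiAlg (β : α → α → Kˣ) (M : Matroid α) (χ : Finset α → K) : Type _ :=
  SqZero β ⧸ chiIdeal β M χ

/-- The class of `e_X` in `A_χ(M)`. -/
def cls (β : α → α → Kˣ) (M : Matroid α) (χ : Finset α → K) (X : Finset α) : ChiAlg β M χ :=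
  (chiIdeal β M χ).mkQ (SqZero.mon β X)

/-- The degree `ℓ` part `A_ℓ` of `A_χ(M)`. -/
def gradedPart (β : α → α → Kˣ) (M : Matroid α) (χ : Finset α → K) (ℓ : ℕ) :
    Submodule K (ChiAlg β M χ) :=
  Submodule.span K {a | ∃ X : Finset α, X.card = ℓ ∧ a = cls β M χ X}

/-! ### Contraction of `χ`-algebras -/

section contraction

variable {β : α → α → Kˣ} {M : Matroid α} {χ : Finset α → K} {x y : α}

lemma isUnidependent_iff {U : Finset α} (hU : (U : Set α) ⊆ M.E) :
    IsUnidependent M U ↔ ¬ M.Indep (U : Set α) ∧ ∃ i ∈ U, M.Indep (U.erase i : Set α) := by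
  constructor
  · rintro ⟨-, C, ⟨hC, hCU⟩, huniq⟩
    refine ⟨fun h => hC.not_indep (h.subset (coe_subset.2 hCU)), ?_⟩
    obtain ⟨i, hi⟩ := hC.nonempty
    refine ⟨i, hCU hi, ?_⟩
    rw [Matroid.indep_iff_forall_subset_not_isCircuit (by
      exact (coe_subset.2 (erase_subset i U)).trans hU)]
    intro D hD hDC
    obtain ⟨D, rfl⟩ := ((finite_toSet _).subset hD).exists_finset_coe
    have hD' := coe_subset.1 hD
    have := huniq D ⟨hDC, hD'.trans (erase_subset _ _)⟩
    subst this
    exact notMem_erase i U (hD' hi)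
  · rintro ⟨hd, i, hi, hind⟩
    refine ⟨hU, ?_⟩
    obtain ⟨C, hCU, hC⟩ := (Matroid.not_indep_iff hU).1 hd |>.exists_isCircuit_subset
    obtain ⟨C, rfl⟩ := ((finite_toSet _).subset hCU).exists_finset_coe
    refine ⟨C, ⟨hC, coe_subset.1 hCU⟩, ?_⟩
    rintro D ⟨hD, hDU⟩
    by_contra hne
    obtain ⟨F, hF, hFc⟩ := hC.elimination hD (fun h => hne (coe_injective h).symm) i
    refine hFc.not_indep (hind.subset (hF.trans ?_))
    rw [coe_erase]
    exact Set.sdiff_subset_sdiff_left (Set.union_subset hCU (coe_subset.2 hDU))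

/-- The boundary formula without the convention for `e_i`. -/
def boundarySum (β : α → α → Kˣ) (χ : Finset α → K) (X : Finset α) : SqZero β :=
  ∑ i ∈ X, ((-1) ^ (X.filter (· ≤ i)).card * χ (X.erase i)) • SqZero.mon β (X.erase i)

lemma boundary_eq_smul (h0 : χ ∅ ≠ 0) (X : Finset α) :
    ∃ c : K, c ≠ 0 ∧ boundary β χ X = c • boundarySum β χ X := by
  by_cases hX : X.card = 1
  · obtain ⟨i, rfl⟩ := card_eq_one.1 hX
    refine ⟨-(χ ∅)⁻¹, by simpa using h0, ?_⟩
    simp [boundary, boundarySum, SqZero.one_def, h0, filter_singleton, smul_smul]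
  · exact ⟨1, one_ne_zero, by simp [boundary, boundarySum, hX]⟩

lemma neg_one_pow_sq (n : ℕ) : ((-1 : K) ^ n) ^ 2 = 1 := by
  rw [← pow_mul, mul_comm, pow_mul, neg_one_sq, one_pow]

lemma sign_erase (V : Finset α) (hy : y ∉ V) {i : α} (hi : i ∈ V) :
    (-1 : K) ^ ((insert y V).filter (· ≤ i)).card * χ ((insert y V).erase i) =
      (-1) ^ (V.filter (y < ·)).card *
        ((-1) ^ (V.filter (· ≤ i)).card * contractChi χ y (V.erase i)) := by
  have hne : y ≠ i := fun h => hy (h ▸ hi)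
  have hyi : y ∉ V.erase i := fun h => hy (mem_of_mem_erase h)
  rw [contractChi_eq χ hyi, erase_insert_of_ne hne, filter_insert, filter_erase]
  rcases lt_or_gt_of_ne hne with h | h
  · have hm : i ∈ V.filter (y < ·) := by simp [hi, h]
    rw [if_pos h.le, card_insert_of_notMem (by simp [hy]), ← card_erase_add_one hm]
    simp only [pow_succ]
    have := neg_one_pow_sq (K := K) ((V.filter (y < ·)).erase i).card
    linear_combination (-1 : K) * (-1) ^ (V.filter (· ≤ i)).card * χ (insert y (V.erase i)) * (- this)
  · rw [if_neg h.not_ge, erase_eq_of_notMem (s := V.filter (y < ·)) (by simp [h.le])]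
    have := neg_one_pow_sq (K := K) (V.filter (y < ·)).card
    linear_combination (-1 : K) ^ (V.filter (· ≤ i)).card * χ (insert y (V.erase i)) * (- this)

lemma IsChi.empty_ne_zero (hχ : IsChi β M χ) : χ ∅ ≠ 0 :=
  (hχ.ne_zero_iff ∅ (by simp)).2 (by simp)

lemma contract_indep_iff (hx : M.IsNonloop x) {X : Finset α} (hX : x ∉ X) :
    (M ／ {x}).Indep (X : Set α) ↔ M.Indep (insert x X : Finset α) := by
  rw [hx.contractElem_indep_iff, coe_insert]; simp [hX]

lemma notMem_of_subset {X : Finset α} (hX : (X : Set α) ⊆ (M ／ {x}).E) : x ∉ X :=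
  fun h => (hX (mem_coe.2 h)).2 rfl

lemma subset_of_subset {X : Finset α} (hX : (X : Set α) ⊆ (M ／ {x}).E) : (X : Set α) ⊆ M.E :=
  hX.trans (M.contract_ground_subset_ground _)

lemma insert_subset_of (hx : M.IsNonloop x) {X : Finset α} (hX : (X : Set α) ⊆ (M ／ {x}).E) :
    ((insert x X : Finset α) : Set α) ⊆ M.E := by
  rw [coe_insert]; exact Set.insert_subset hx.mem_ground (subset_of_subset hX)

lemma IsUnidependent.insert (hx : M.IsNonloop x) {U : Finset α}
    (hU : IsUnidependent (M ／ {x}) U) : IsUnidependent M (insert x U) := by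
  have hxU := notMem_of_subset hU.1
  obtain ⟨h1, i, hi, h2⟩ := (isUnidependent_iff hU.1).1 hU
  have hne : x ≠ i := fun h => hxU (h ▸ hi)
  rw [isUnidependent_iff (insert_subset_of hx hU.1)]
  refine ⟨by rwa [← contract_indep_iff hx hxU], i, mem_insert_of_mem hi, ?_⟩
  rw [erase_insert_of_ne hne, ← contract_indep_iff hx (fun h => hxU (mem_of_mem_erase h))]
  exact h2

/-- Coefficient extraction `e_X ↦ e_{X \ x}` for `x ∈ X`, and `e_X ↦ 0` otherwise. -/
def extract (β : α → α → Kˣ) (x : α) : SqZero β →ₗ[K] SqZero β :=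
  (SqZero.basis β).constr K fun X => if x ∈ X then SqZero.mon β (X.erase x) else 0

lemma extract_mon (X : Finset α) : extract β x (SqZero.mon β X) =
    if x ∈ X then SqZero.mon β (X.erase x) else 0 := by
  simp [extract, SqZero.mon]

lemma extract_mul (a : SqZero β) {W : Finset α} (hW : x ∉ W) :
    extract β x (a * SqZero.mon β W) =
      SqZero.coeff β {x} W • (extract β x a * SqZero.mon β W) := by
  induction a using SqZero.induction_mon with
  | zero => simp
  | add a b ha hb => simp [add_mul, ha, hb]
  | smul c a ha => simp [ha, smul_comm c]
  | mon Y =>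
    rw [SqZero.mon_mul_mon, extract_mon]
    by_cases hY : x ∈ Y
    · rw [if_pos hY, SqZero.mon_mul_mon]
      have hd : Disjoint (Y.erase x) W ↔ Disjoint Y W := by
        conv_rhs => rw [← insert_erase hY]
        simp [disjoint_insert_left, hW]
      have hc : SqZero.coeff β Y W = SqZero.coeff β {x} W * SqZero.coeff β (Y.erase x) W := by
        rw [← SqZero.coeff_union_left β (by simp), ← insert_eq, insert_erase hY]
      by_cases h : Disjoint Y W
      · rw [if_pos h, if_pos (hd.2 h), map_smul, extract_mon, if_pos (mem_union_left _ hY), hc,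
          mul_smul, erase_union_distrib, erase_eq_of_notMem hW]
      · rw [if_neg h, if_neg (fun h' => h (hd.1 h'))]; simp
    · rw [if_neg hY]
      split_ifs
      · simp [extract_mon, hY, hW]
      · simp

lemma extract_boundarySum {U : Finset α} (hU : x ∉ U) :
    extract β x (boundarySum β χ (insert x U)) =
      (-1 : K) ^ (U.filter (x < ·)).card • boundarySum β (contractChi χ x) U := by
  rw [boundarySum, boundarySum, sum_insert hU, map_add, map_smul, extract_mon,
    if_neg (notMem_erase _ _), smul_zero, zero_add, map_sum, smul_sum]
  refine sum_congr rfl fun i hi => ?_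
  have hne : x ≠ i := fun h => hU (h ▸ hi)
  rw [map_smul, extract_mon, if_pos (by simp [hne]), sign_erase U hU hi, smul_smul,
    erase_insert_of_ne hne, erase_insert (fun h => hU (mem_of_mem_erase h))]

/-- The map `χ_{M/x}` defines a `χ`-algebra of `M/x`. -/
lemma IsChi.contract (hχ : IsChi β M χ) (hx : M.IsNonloop x) :
    IsChi β (M ／ {x}) (contractChi χ x) := by
  have hne : ∀ X : Finset α, (X : Set α) ⊆ (M ／ {x}).E →
      (contractChi χ x X ≠ 0 ↔ (M ／ {x}).Indep (X : Set α)) := by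
    intro X hX
    rw [contract_indep_iff hx (notMem_of_subset hX), contractChi_eq χ (notMem_of_subset hX),
      ← hχ.ne_zero_iff _ (insert_subset_of hx hX)]
    simp
  refine ⟨hne, fun U U' hU hU' hUU' => ?_⟩
  have hxU := notMem_of_subset hU.1
  have hxU' := notMem_of_subset hU'.1
  obtain ⟨ε, hε⟩ := hχ.boundary_eq _ _ (hU.insert hx) (hU'.insert hx) (insert_subset_insert x hUU')
  have h0 := hχ.empty_ne_zero
  have h0' : contractChi χ x ∅ ≠ 0 := (hne ∅ (by simp)).2 (by simp)
  obtain ⟨c1, hc1, e1⟩ := boundary_eq_smul (β := β) h0 (insert x U)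
  obtain ⟨c2, hc2, e2⟩ := boundary_eq_smul (β := β) h0 (insert x U')
  obtain ⟨c3, hc3, e3⟩ := boundary_eq_smul (β := β) h0' U
  obtain ⟨c4, hc4, e4⟩ := boundary_eq_smul (β := β) h0' U'
  have hW : insert x U \ insert x U' = U \ U' := by
    ext z; simp only [mem_sdiff, mem_insert]
    constructor
    · rintro ⟨h | h, h'⟩
      · exact absurd (Or.inl h) h'
      · exact ⟨h, fun h'' => h' (Or.inr h'')⟩
    · rintro ⟨h, h'⟩
      refine ⟨Or.inr h, ?_⟩
      rintro (rfl | h'')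
      · exact hxU h
      · exact h' h''
  have hxW : x ∉ U \ U' := fun h => hxU (mem_sdiff.1 h).1
  rw [e1, e2, hW] at hε
  have key := congrArg (extract β x) hε
  rw [map_smul, extract_boundarySum hxU, map_smul, smul_mul_assoc, map_smul, extract_mul _ hxW,
    extract_boundarySum hxU', smul_mul_assoc] at key
  simp only [smul_smul] at key
  have hs : ∀ n : ℕ, (-1 : K) ^ n ≠ 0 := fun n => pow_ne_zero _ (by simp)
  have hl := mul_ne_zero hc1 (hs (U.filter (x < ·)).card)
  have hr := mul_ne_zero (mul_ne_zero (mul_ne_zero ε.ne_zero hc2)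
    (SqZero.coeff_ne_zero β {x} (U \ U'))) (hs (U'.filter (x < ·)).card)
  rw [← eq_inv_smul_iff₀ hl, smul_smul] at key
  refine ⟨Units.mk0 _ (mul_ne_zero (mul_ne_zero hc3 (mul_ne_zero (inv_ne_zero hl) hr))
    (inv_ne_zero hc4)), ?_⟩
  rw [e3, e4, key, Units.val_mk0, smul_mul_assoc, smul_smul, smul_smul, inv_mul_cancel_right₀ hc4]
  simp only [mul_assoc]

/-! ### The residue maps -/

open Classical in
/-- The value of the residue `𝔭_x` on the monomial `e_X`, for independent `X`:
`e_{X \ x}` if `x ∈ X`; `χ(X \ y, x) / χ(X \ y, y) e_{X \ y}` if `y ∈ X` is parallel to `x`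
(the sum below has at most one term, an independent set having no two parallel elements);
and `0` otherwise. Dependent monomials, whose classes in `A_χ(M)` vanish, are sent to `0`. -/
def residueMon (β : α → α → Kˣ) (M : Matroid α) (χ : Finset α → K) (x : α) (X : Finset α) :
    SqZero β :=
  if M.Indep (X : Set α) then
    if x ∈ X then SqZero.mon β (X.erase x)
    else ∑ y ∈ X with M.IsCircuit {x, y},
      (contractChi χ x (X.erase y) / contractChi χ y (X.erase y)) • SqZero.mon β (X.erase y)
  else 0

/-- The residue on the level of monomials. -/
def rawResidue (β : α → α → Kˣ) (M : Matroid α) (χ : Finset α → K) (x : α) :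
    SqZero β →ₗ[K] SqZero β :=
  (SqZero.basis β).constr K (residueMon β M χ x)

lemma rawResidue_mon (X : Finset α) :
    rawResidue β M χ x (SqZero.mon β X) = residueMon β M χ x X := by
  simp [rawResidue, SqZero.mon]

/-- `y` is equal or parallel to the nonloop `x`. -/
def Par (M : Matroid α) (x y : α) : Prop := M.IsNonloop y ∧ M.closure {y} = M.closure {x}

lemma par_iff (hx : M.IsNonloop x) (hne : x ≠ y) : Par M x y ↔ M.IsCircuit {x, y} := by
  rw [← hx.closure_eq_closure_iff_isCircuit_of_ne hne]
  constructor
  · exact fun h => h.2.symm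
  · intro h
    refine ⟨?_, h.symm⟩
    have hC := (hx.closure_eq_closure_iff_isCircuit_of_ne hne).1 h
    exact hC.isNonloop_of_mem (Set.nontrivial_pair hne) (by simp)

lemma Par.isCircuit {z : α} (hy : Par M x y) (hz : Par M x z) (hne : y ≠ z) :
    M.IsCircuit {y, z} :=
  (hy.1.closure_eq_closure_iff_isCircuit_of_ne hne).1 (hy.2.trans hz.2.symm)

lemma Par.mem_closure_iff (hx : M.IsNonloop x) (hy : Par M x y) (Z : Set α) :
    y ∈ M.closure Z ↔ x ∈ M.closure Z := by
  have key : ∀ {a : α}, M.IsNonloop a → (a ∈ M.closure Z ↔ M.closure {a} ⊆ M.closure Z) := by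
    intro a ha
    refine ⟨fun h => M.closure_subset_closure_of_subset_closure (by simpa using h), fun h => h ?_⟩
    exact M.mem_closure_self a ha.mem_ground
  rw [key hx, key hy.1, hy.2]

lemma Par.indep_insert_iff (hx : M.IsNonloop x) (hy : Par M x y) {Z : Finset α}
    (hxZ : x ∉ Z) (hyZ : y ∉ Z) :
    M.Indep (insert y Z : Finset α) ↔ M.Indep (insert x Z : Finset α) := by
  by_cases hZ : M.Indep (Z : Set α)
  · rw [coe_insert, coe_insert, hZ.insert_indep_iff_of_notMem (by simpa using hyZ),
      hZ.insert_indep_iff_of_notMem (by simpa using hxZ), Set.mem_sdiff, Set.mem_sdiff,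
      hy.mem_closure_iff hx]
    simp [hx.mem_ground, hy.1.mem_ground]
  · constructor <;> intro h <;> exact absurd (h.subset (by simp)) hZ

lemma residueMon_of_not_indep {X : Finset α} (hX : ¬ M.Indep (X : Set α)) :
    residueMon β M χ x X = 0 := if_neg hX

lemma residueMon_of_par (hχ : IsChi β M χ) (hx : M.IsNonloop x) {X : Finset α}
    (hX : M.Indep (X : Set α)) (hy : Par M x y) (hyX : y ∈ X) :
    residueMon β M χ x X = (contractChi χ x (X.erase y) / contractChi χ y (X.erase y)) •
      SqZero.mon β (X.erase y) := by
  classical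
  have hpair : ∀ z ∈ X, Par M x z → z = y := by
    intro z hz hpz
    by_contra hne
    refine (hpz.isCircuit hy hne).not_indep (hX.subset ?_)
    rintro w (rfl | rfl) <;> assumption
  rw [residueMon, if_pos hX]
  split_ifs with hxX
  · obtain rfl := hpair x hxX ⟨hx, rfl⟩
    have : contractChi χ x (X.erase x) ≠ 0 := by
      rw [contractChi_eq χ (notMem_erase _ _), insert_erase hxX]
      exact mul_ne_zero (pow_ne_zero _ (by simp)) ((hχ.ne_zero_iff _ hX.subset_ground).2 hX)
    rw [div_self this, one_smul]
  · rw [sum_eq_single_of_mem y]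
    · have hne : x ≠ y := fun h => hxX (h ▸ hyX)
      simp [hyX, (par_iff hx hne).1 hy]
    · intro z hz hzy
      rw [mem_filter] at hz
      have hne : x ≠ z := fun h => hxX (h ▸ hz.1)
      exact absurd (hpair z hz.1 ((par_iff hx hne).2 hz.2)) hzy

lemma residueMon_of_not_par (hx : M.IsNonloop x) {X : Finset α} (h : ∀ y ∈ X, ¬ Par M x y) :
    residueMon β M χ x X = 0 := by
  classical
  rw [residueMon]
  split_ifs with h1 h2
  · exact absurd ⟨hx, rfl⟩ (h x h2)
  · refine sum_eq_zero fun z hz => ?_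
    rw [mem_filter] at hz
    have hne : x ≠ z := fun h' => h2 (h' ▸ hz.1)
    exact absurd ((par_iff hx hne).2 hz.2) (h z hz.1)
  · rfl

lemma boundary_mem_of_isUnidependent (hχ : IsChi β M χ) {U C : Finset α}
    (hU : IsUnidependent M U) (hC : M.IsCircuit (C : Set α)) (hCU : C ⊆ U) (h1 : 1 < C.card) :
    boundary β χ U ∈ chiIdeal β M χ := by
  have hCu : IsUnidependent M C :=
    ⟨hC.subset_ground, C, ⟨hC, Subset.rfl⟩, fun D hD =>
      coe_injective (hD.1.eq_of_subset_isCircuit hC (coe_subset.2 hD.2))⟩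
  obtain ⟨ε, hε⟩ := hχ.boundary_eq U C hU hCu hCU
  rw [hε]
  exact Submodule.smul_mem _ _ (Submodule.subset_span ⟨_, Or.inl ⟨C, hC, h1, rfl⟩, _, rfl⟩)

lemma IsUnidependent.subset_of_indep_erase {U C : Finset α} {i : α}
    (hi : M.Indep (U.erase i : Set α)) (hC : M.IsCircuit (C : Set α)) (hCU : C ⊆ U) : i ∈ C := by
  by_contra h
  exact hC.not_indep (hi.subset (coe_subset.2 fun z hz =>
    mem_erase.2 ⟨fun e => h (e ▸ hz), hCU hz⟩))

lemma rawResidue_boundarySum_mem (hχ : IsChi β M χ) (hx : M.IsNonloop x) {U C : Finset α}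
    (hU : IsUnidependent M U) (hC : M.IsCircuit (C : Set α)) (hCU : C ⊆ U) (h1 : 1 < C.card) :
    rawResidue β M χ x (boundarySum β χ U) ∈
      chiIdeal β (M ／ {x}) (contractChi χ x) := by
  have huniq : ∀ D : Finset α, M.IsCircuit (D : Set α) → D ⊆ U → D = C := by
    obtain ⟨-, F, -, hF⟩ := hU
    intro D hD hDU
    rw [hF D ⟨hD, hDU⟩, hF C ⟨hC, hCU⟩]
  have hzero : ∀ i ∈ U, i ∉ C → χ (U.erase i) = 0 := by
    intro i hi hiC
    by_contra h
    exact hiC (IsUnidependent.subset_of_indep_erase ((hχ.ne_zero_iff _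
      ((coe_subset.2 (erase_subset i U)).trans hU.1)).1 h) hC hCU)
  have hind : ∀ i ∈ C, M.Indep (U.erase i : Set α) := by
    intro i hi
    rw [Matroid.indep_iff_forall_subset_not_isCircuit (by
      exact (coe_subset.2 (erase_subset i U)).trans hU.1)]
    intro D hD hDC
    obtain ⟨D, rfl⟩ := ((finite_toSet _).subset hD).exists_finset_coe
    have hD' := coe_subset.1 hD
    have := huniq D hDC (hD'.trans (erase_subset _ _))
    subst this
    exact notMem_erase i U (hD' hi)
  rw [boundarySum, map_sum]
  simp only [map_smul, rawResidue_mon]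
  by_cases hA : ∃ y ∈ U, Par M x y
  swap
  · rw [sum_eq_zero]
    · exact zero_mem _
    intro i hi
    rw [residueMon_of_not_par hx, smul_zero]
    intro y hy hp
    exact hA ⟨y, mem_of_mem_erase hy, hp⟩
  obtain ⟨y, hyU, hy⟩ := hA
  by_cases hB : ∃ z ∈ U, Par M x z ∧ z ≠ y
  · obtain ⟨z, hzU, hz, hzy⟩ := hB
    have hCeq : C = {y, z} := by
      refine (huniq {y, z} ?_ ?_).symm
      · rw [coe_pair]; exact hy.isCircuit hz hzy.symm
      · rintro w hw
        rcases mem_insert.1 hw with rfl | hw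
        · exact hyU
        · rw [mem_singleton.1 hw]; exact hzU
    have hyC : y ∈ C := by simp [hCeq]
    have hzC : z ∈ C := by simp [hCeq]
    obtain ⟨W, hyW, hzW, hW⟩ : ∃ W, y ∉ W ∧ z ∉ W ∧ U = insert y (insert z W) := by
      refine ⟨(U.erase y).erase z, by simp, by simp, ?_⟩
      rw [insert_erase (mem_erase.2 ⟨hzy, hzU⟩), insert_erase hyU]
    have e1 : U.erase y = insert z W := by rw [hW, erase_insert]; simp [hyW, hzy.symm]
    have e2 : U.erase z = insert y W := by
      rw [hW, Finset.insert_comm, erase_insert]; simp [hzW, hzy]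
    rw [← sum_subset hCU (fun i hi hiC => by rw [hzero i hi hiC]; simp), hCeq,
      sum_pair hzy.symm,
      residueMon_of_par hχ hx (hind y hyC) hz (mem_erase.2 ⟨hzy, hzU⟩),
      residueMon_of_par hχ hx (hind z hzC) hy (mem_erase.2 ⟨hzy.symm, hyU⟩)]
    have e3 : (U.erase y).erase z = W := by rw [e1, erase_insert hzW]
    have e4 : (U.erase z).erase y = W := by rw [e2, erase_insert hyW]
    have n1 : χ (insert z W) ≠ 0 := by
      rw [← e1]; exact (hχ.ne_zero_iff _ (hind y hyC).subset_ground).2 (hind y hyC)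
    have n2 : χ (insert y W) ≠ 0 := by
      rw [← e2]; exact (hχ.ne_zero_iff _ (hind z hzC).subset_ground).2 (hind z hzC)
    rw [e3, e4, e1, e2, contractChi_eq χ hzW, contractChi_eq χ hyW, smul_smul, smul_smul,
      ← add_smul]
    have s1 : ∀ n : ℕ, ((-1 : K) ^ n)⁻¹ = (-1) ^ n := fun n => by
      rw [inv_eq_iff_eq_inv]; exact (eq_inv_of_mul_eq_one_left (by
        rw [← pow_two]; exact neg_one_pow_sq n))
    have hcard : ∀ w, w ∉ W → (W.filter (w < ·)).card + (W.filter (· ≤ w)).card = W.card := by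
      intro w hw
      rw [add_comm, ← card_filter_add_card_filter_not (s := W) (· ≤ w)]
      simp
    have key : ((-1 : K) ^ (U.filter (· ≤ y)).card * χ (insert z W) *
          (contractChi χ x W / ((-1) ^ (W.filter (z < ·)).card * χ (insert z W))) +
        (-1) ^ (U.filter (· ≤ z)).card * χ (insert y W) *
          (contractChi χ x W / ((-1) ^ (W.filter (y < ·)).card * χ (insert y W)))) = 0 := by
      have t1 : (-1 : K) ^ (U.filter (· ≤ y)).card * χ (insert z W) *
          (contractChi χ x W / ((-1) ^ (W.filter (z < ·)).card * χ (insert z W))) =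
          (-1) ^ ((U.filter (· ≤ y)).card + (W.filter (z < ·)).card) * contractChi χ x W := by
        rw [div_eq_mul_inv, mul_inv, s1, pow_add]; field_simp
      have t2 : (-1 : K) ^ (U.filter (· ≤ z)).card * χ (insert y W) *
          (contractChi χ x W / ((-1) ^ (W.filter (y < ·)).card * χ (insert y W))) =
          (-1) ^ ((U.filter (· ≤ z)).card + (W.filter (y < ·)).card) * contractChi χ x W := by
        rw [div_eq_mul_inv, mul_inv, s1, pow_add]; field_simp
      rw [t1, t2, ← add_mul]
      have hy' := hcard y hyW
      have hz' := hcard z hzW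
      have hpar : Odd ((U.filter (· ≤ y)).card + (W.filter (z < ·)).card +
          ((U.filter (· ≤ z)).card + (W.filter (y < ·)).card)) := by
        rw [hW, filter_insert, filter_insert, filter_insert, filter_insert]
        rcases lt_or_gt_of_ne hzy with h | h
        · rw [if_pos le_rfl, if_pos h.le, if_neg h.not_ge, if_pos le_rfl,
            card_insert_of_notMem (by simp [hyW, hzy.symm]), card_insert_of_notMem (by simp [hzW]),
            card_insert_of_notMem (by simp [hzW])]
          exact ⟨W.card + 1, by omega⟩
        · rw [if_pos le_rfl, if_neg h.not_ge, if_pos h.le, if_pos le_rfl,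
            card_insert_of_notMem (by simp [hyW]),
            card_insert_of_notMem (by simp [hyW, hzy.symm]), card_insert_of_notMem (by simp [hzW])]
          exact ⟨W.card + 1, by omega⟩
      rcases neg_one_pow_eq_or K ((U.filter (· ≤ y)).card + (W.filter (z < ·)).card) with h | h <;>
      rcases neg_one_pow_eq_or K ((U.filter (· ≤ z)).card + (W.filter (y < ·)).card) with h' | h' <;>
        have := hpar.neg_one_pow (α := K) <;> rw [pow_add _ (_ + _), h, h'] at this <;>
        rw [h, h'] <;> first
          | ring1
          | linear_combination (contractChi χ x W) * this
          | linear_combination -(contractChi χ x W) * this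
    rw [key, zero_smul]
    exact zero_mem _
  · push Not at hB
    have hyV : y ∉ U.erase y := notMem_erase y U
    have hxV : x ∉ U.erase y := fun h =>
      (mem_erase.1 h).1 (hB x (mem_of_mem_erase h) ⟨hx, rfl⟩)
    have hUV : insert y (U.erase y) = U := insert_erase hyU
    have hsub : ∀ i ∈ U.erase y, (U.erase i).erase y = (U.erase y).erase i := fun i _ =>
      erase_right_comm
    have hswap : ∀ Z ⊆ U.erase y,
        (M.Indep (insert y Z : Finset α) ↔ M.Indep (insert x Z : Finset α)) := fun Z hZ =>
      hy.indep_insert_iff hx (fun h => hxV (hZ h)) (fun h => hyV (hZ h))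
    have hVE : ((U.erase y : Finset α) : Set α) ⊆ (M ／ {x}).E := by
      intro z hz
      exact ⟨hU.1 (mem_coe.2 (mem_of_mem_erase (mem_coe.1 hz))), fun h => hxV (by
        rw [← Set.mem_singleton_iff.1 h]; exact hz)⟩
    have hVi : ∀ i, (((U.erase y).erase i : Finset α) : Set α) ⊆ (M ／ {x}).E := fun i =>
      (coe_subset.2 (erase_subset _ _)).trans hVE
    have hχ' := hχ.contract hx
    have hins : ∀ i ∈ U.erase y, insert y ((U.erase y).erase i) = U.erase i := fun i hi => by
      rw [← hsub i hi, insert_erase]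
      exact mem_erase.2 ⟨(mem_erase.1 hi).1.symm, hyU⟩
    -- the image is a multiple of the boundary of `U \ y` in the contraction
    have main : ∑ i ∈ U, ((-1 : K) ^ (U.filter (· ≤ i)).card * χ (U.erase i)) •
        residueMon β M χ x (U.erase i) =
        (-1 : K) ^ ((U.erase y).filter (y < ·)).card •
          boundarySum β (contractChi χ x) (U.erase y) := by
      rw [← add_sum_erase U _ hyU, residueMon_of_not_par hx (fun z hz hp =>
        (mem_erase.1 hz).1 (hB z (mem_of_mem_erase hz) hp)), smul_zero, zero_add, boundarySum,
        smul_sum]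
      refine sum_congr rfl fun i hi => ?_
      have hsign := sign_erase (χ := χ) (U.erase y) hyV hi
      rw [hUV] at hsign
      have hyi : y ∈ U.erase i := mem_erase.2 ⟨(mem_erase.1 hi).1.symm, hyU⟩
      have hiff : M.Indep (U.erase i : Set α) ↔ contractChi χ x ((U.erase y).erase i) ≠ 0 := by
        rw [hχ'.ne_zero_iff _ (hVi i), contract_indep_iff hx (fun h => hxV (mem_of_mem_erase h)),
          ← hswap _ (erase_subset _ _), hins i hi]
      by_cases hI : M.Indep (U.erase i : Set α)
      · rw [residueMon_of_par hχ hx hI hy hyi, hsub i hi, smul_smul, smul_smul, hsign]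
        have hn : contractChi χ y ((U.erase y).erase i) ≠ 0 := by
          rw [contractChi_eq χ (fun h => hyV (mem_of_mem_erase h)), hins i hi]
          exact mul_ne_zero (pow_ne_zero _ (by simp)) ((hχ.ne_zero_iff _ hI.subset_ground).2 hI)
        congr 1
        field_simp
      · rw [residueMon_of_not_indep hI, not_not.1 (fun h => hI (hiff.2 h))]
        simp
    rw [main]
    have hVu : IsUnidependent (M ／ {x}) (U.erase y) := by
      rw [isUnidependent_iff hVE, contract_indep_iff hx hxV, ← hswap _ Subset.rfl, hUV]
      refine ⟨fun h => hC.not_indep (h.subset (coe_subset.2 hCU)), ?_⟩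
      obtain ⟨i, hi, hiy⟩ := exists_mem_ne h1 y
      have hiV : i ∈ U.erase y := mem_erase.2 ⟨hiy, hCU hi⟩
      refine ⟨i, hiV, ?_⟩
      rw [contract_indep_iff hx (fun h => hxV (mem_of_mem_erase h)), ← hswap _ (erase_subset _ _),
        hins i hiV]
      exact hind i hi
    obtain ⟨-, D, ⟨hD, hDV⟩, -⟩ := id hVu
    have hD1 : 1 < D.card := by
      by_contra hle
      have hpos : 0 < D.card := card_pos.2 (by simpa using hD.nonempty)
      obtain ⟨z, rfl⟩ := card_eq_one.1 (show D.card = 1 by omega)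
      have hzV : z ∈ U.erase y := hDV (by simp)
      rw [coe_singleton, Matroid.singleton_isCircuit, Matroid.contract_isLoop_iff_mem_closure] at hD
      have hzn : M.IsNonloop z := by
        rw [← Matroid.not_isLoop_iff (hU.1 (mem_coe.2 (mem_of_mem_erase hzV)))]
        intro hl
        have := huniq {z} (by simpa using hl) (by simpa using mem_of_mem_erase hzV)
        rw [← this, card_singleton] at h1
        omega
      exact (mem_erase.1 hzV).1 (hB z (mem_of_mem_erase hzV)
        ⟨hzn, hzn.closure_eq_of_mem_closure hD.1⟩)
    obtain ⟨c, hc, e⟩ := boundary_eq_smul (β := β) hχ'.empty_ne_zero (U.erase y)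
    have hmem := boundary_mem_of_isUnidependent hχ' hVu hD hDV hD1
    rw [e] at hmem
    exact Submodule.smul_mem _ _ ((Submodule.smul_mem_iff _ hc).1 hmem)

/-- `𝔭_x` maps the defining ideal of `A_χ(M)` into that of `A_{χ_{M/x}}(M/x)`. -/
lemma chiIdeal_le_comap (hχ : IsChi β M χ) (hx : M.IsNonloop x) :
    chiIdeal β M χ ≤ (chiIdeal β (M ／ {x}) (contractChi χ x)).comap (rawResidue β M χ x) := by
  rw [chiIdeal, Submodule.span_le]
  rintro _ ⟨g, hg, b, rfl⟩
  rw [SetLike.mem_coe, Submodule.mem_comap]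
  induction b using SqZero.induction_mon with
  | zero => simp
  | add a b ha hb => rw [mul_add, map_add]; exact add_mem ha hb
  | smul c a ha => rw [mul_smul_comm, map_smul]; exact Submodule.smul_mem _ _ ha
  | mon Y =>
    rcases hg with ⟨C, hC, h1, rfl⟩ | ⟨i, hi, rfl⟩
    · obtain ⟨c, hc, e⟩ := boundary_eq_smul (β := β) hχ.empty_ne_zero C
      by_cases h : Disjoint C Y ∧ IsUnidependent M (C ∪ Y)
      · obtain ⟨hd, hU⟩ := h
        have hCu : IsUnidependent M C :=
          ⟨hC.subset_ground, C, ⟨hC, Subset.rfl⟩, fun D hD =>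
            coe_injective (hD.1.eq_of_subset_isCircuit hC (coe_subset.2 hD.2))⟩
        obtain ⟨ε, hε⟩ := hχ.boundary_eq (C ∪ Y) C hU hCu subset_union_left
        rw [union_sdiff_cancel_left hd] at hε
        obtain ⟨c', hc', e'⟩ := boundary_eq_smul (β := β) hχ.empty_ne_zero (C ∪ Y)
        rw [← Submodule.smul_mem_iff _ ε.ne_zero, ← map_smul, ← hε, e', map_smul]
        exact Submodule.smul_mem _ _
          (rawResidue_boundarySum_mem hχ hx hU hC subset_union_left h1)
      · rw [e, boundarySum, smul_mul_assoc, sum_mul, map_smul, map_sum, sum_eq_zero]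
        · simp
        intro i hi
        rw [smul_mul_assoc, map_smul, SqZero.mon_mul_mon]
        split_ifs with hd
        · rw [map_smul, rawResidue_mon, residueMon_of_not_indep]
          · simp
          intro hind
          have hCY : ¬ M.Indep ((C ∪ Y : Finset α) : Set α) := fun h' =>
            hC.not_indep (h'.subset (coe_subset.2 subset_union_left))
          by_cases hiY : i ∈ Y
          · refine hCY (hind.subset (coe_subset.2 ?_))
            intro z hz
            rcases mem_union.1 hz with hz | hz
            · by_cases hzi : z = i
              · exact mem_union_right _ (hzi ▸ hiY)
              · exact mem_union_left _ (mem_erase.2 ⟨hzi, hz⟩)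
            · exact mem_union_right _ hz
          · refine h ⟨?_, ?_⟩
            · rw [← insert_erase hi, disjoint_insert_left]; exact ⟨hiY, hd⟩
            · have hE : ((C ∪ Y : Finset α) : Set α) ⊆ M.E := by
                rw [coe_union]
                refine Set.union_subset hC.subset_ground (subset_trans ?_ hind.subset_ground)
                exact coe_subset.2 subset_union_right
              rw [isUnidependent_iff hE]
              refine ⟨hCY, i, mem_union_left _ hi, ?_⟩
              rwa [erase_union_distrib, erase_eq_of_notMem hiY]
        · simp
    · rw [SqZero.gen, SqZero.mon_mul_mon]
      split_ifs
      · rw [map_smul, rawResidue_mon, residueMon_of_not_indep]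
        · simp
        intro hind
        have hiX : i ∈ (({i} ∪ Y : Finset α) : Set α) := by simp
        rcases hi with hi | hi
        · exact hi.notMem_of_indep hind hiX
        · exact hi (hind.subset_ground hiX)
      · simp

variable (β M χ x) in
/-- The residue map `𝔭_x : A_χ(M) → A_{χ_{M/x}}(M/x)` for a nonloop `x`. -/
def residue (hχ : IsChi β M χ) (hx : M.IsNonloop x) :
    ChiAlg β M χ →ₗ[K] ChiAlg β (M ／ {x}) (contractChi χ x) :=
  Submodule.mapQ _ _ (rawResidue β M χ x) (chiIdeal_le_comap hχ hx)

lemma residue_of_mem (hχ : IsChi β M χ) (hx : M.IsNonloop x) {I : Finset α}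
    (hI : M.Indep (I : Set α)) (hxI : x ∈ I) :
    residue β M χ x hχ hx (cls β M χ I) = cls β (M ／ {x}) (contractChi χ x) (I.erase x) := by
  simp [residue, cls, rawResidue_mon, residueMon, hI, hxI]

lemma residue_of_parallel (hχ : IsChi β M χ) (hx : M.IsNonloop x) {I : Finset α}
    (hI : M.Indep (I : Set α)) (hyI : y ∈ I) (hxy : x ≠ y) (hy : M.IsCircuit {x, y}) :
    residue β M χ x hχ hx (cls β M χ I) =
      (contractChi χ x (I.erase y) / contractChi χ y (I.erase y)) •
        cls β (M ／ {x}) (contractChi χ x) (I.erase y) := by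
  simp [residue, cls, rawResidue_mon, residueMon_of_par hχ hx hI ((par_iff hx hxy).2 hy) hyI]

lemma residue_of_not (hχ : IsChi β M χ) (hx : M.IsNonloop x) {I : Finset α}
    (hxI : x ∉ I) (h : ∀ y ∈ I, ¬ M.IsCircuit {x, y}) :
    residue β M χ x hχ hx (cls β M χ I) = 0 := by
  have : residueMon β M χ x I = 0 := residueMon_of_not_par hx fun y hy hp =>
    h y hy ((par_iff hx fun e => hxI (e ▸ hy)).1 hp)
  simp [residue, cls, rawResidue_mon, this]

/-! ### Iterated residues -/

lemma chiIdeal_le_ker (hχ : IsChi β M χ) :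
    chiIdeal β M χ ≤ LinearMap.ker ((SqZero.basis β).coord ∅) := by
  have hc : ∀ X, X ≠ ∅ → (SqZero.basis β).coord ∅ (SqZero.mon β X) = 0 := fun X hX => by
    simp [SqZero.mon, hX]
  rw [chiIdeal, Submodule.span_le]
  rintro _ ⟨g, hg, b, rfl⟩
  rw [SetLike.mem_coe, LinearMap.mem_ker]
  induction b using SqZero.induction_mon with
  | zero => simp
  | add a b ha hb => rw [mul_add, map_add, ha, hb, add_zero]
  | smul c a ha => rw [mul_smul_comm, map_smul, ha, smul_zero]
  | mon Y =>
    rcases hg with ⟨C, hC, h1, rfl⟩ | ⟨i, hi, rfl⟩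
    · obtain ⟨c, -, e⟩ := boundary_eq_smul (β := β) hχ.empty_ne_zero C
      rw [e, boundarySum, smul_mul_assoc, sum_mul, map_smul, map_sum, sum_eq_zero, smul_zero]
      intro i hi
      rw [smul_mul_assoc, map_smul, SqZero.mon_mul_mon]
      split_ifs
      · rw [map_smul, hc, smul_zero, smul_zero]
        have : (C.erase i).Nonempty := card_pos.1 (by rw [card_erase_of_mem hi]; omega)
        exact (this.mono subset_union_left).ne_empty
      · simp
    · rw [SqZero.gen, SqZero.mon_mul_mon]
      split_ifs
      · rw [map_smul, hc _ (by simp), smul_zero]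
      · simp

variable (β M χ) in
/-- The projection of `A_χ(M)` onto its degree `0` part, identified with `K`. -/
def degZero (hχ : IsChi β M χ) : ChiAlg β M χ →ₗ[K] K :=
  (chiIdeal β M χ).liftQ ((SqZero.basis β).coord ∅) (chiIdeal_le_ker hχ)

lemma degZero_cls_empty (hχ : IsChi β M χ) : degZero β M χ hχ (cls β M χ ∅) = 1 := by
  simp [degZero, cls, SqZero.mon]

end contraction

/-- `f` lists the elements of an independent set of `M` without repetition. -/
structure IsOrdIndep (M : Matroid α) {ℓ : ℕ} (f : Fin ℓ → α) : Prop where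
  injective : Function.Injective f
  indep : M.Indep (Set.range f)

lemma IsOrdIndep.isNonloop {M : Matroid α} {ℓ : ℕ} {f : Fin (ℓ + 1) → α} (hf : IsOrdIndep M f) :
    M.IsNonloop (f (Fin.last ℓ)) :=
  hf.indep.isNonloop_of_mem ⟨_, rfl⟩

lemma IsOrdIndep.init {M : Matroid α} {ℓ : ℕ} {f : Fin (ℓ + 1) → α} (hf : IsOrdIndep M f) :
    IsOrdIndep (M ／ {f (Fin.last ℓ)}) (Fin.init f) := by
  refine ⟨hf.injective.comp (Fin.castSucc_injective ℓ), ?_⟩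
  rw [hf.isNonloop.contractElem_indep_iff]
  constructor
  · rintro ⟨i, hi⟩
    exact (Fin.castSucc_lt_last i).ne (hf.injective hi)
  · refine hf.indep.subset (Set.insert_subset ⟨_, rfl⟩ ?_)
    rintro _ ⟨i, rfl⟩
    exact ⟨_, rfl⟩

/-- The composite `𝔭_{f 0} ∘ ⋯ ∘ 𝔭_{f (ℓ-1)}` of residues along an ordered independent set
(`f (ℓ-1)` is contracted first), followed by the degree `0` part. -/
def residueChain (β : α → α → Kˣ) : ∀ {ℓ : ℕ} (M : Matroid α) (χ : Finset α → K)
    (_ : IsChi β M χ) (f : Fin ℓ → α) (_ : IsOrdIndep M f), ChiAlg β M χ →ₗ[K] K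
  | 0, M, χ, hχ, _, _ => degZero β M χ hχ
  | ℓ + 1, M, χ, hχ, f, hf =>
    residueChain β (M ／ {f (Fin.last ℓ)}) (contractChi χ (f (Fin.last ℓ)))
      (hχ.contract hf.isNonloop) (Fin.init f) hf.init ∘ₗ
      residue β M χ (f (Fin.last ℓ)) hχ hf.isNonloop

/-- The iterated residue `𝔭_f : A_ℓ → K` with respect to the ordered independent set
`f = (f 0, …, f (ℓ-1))`. -/
def iteratedResidue (β : α → α → Kˣ) {ℓ : ℕ} (M : Matroid α) (χ : Finset α → K)
    (hχ : IsChi β M χ) (f : Fin ℓ → α) (hf : IsOrdIndep M f) :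
    gradedPart β M χ ℓ →ₗ[K] K :=
  (residueChain β M χ hχ f hf).domRestrict (gradedPart β M χ ℓ)

/-- The class of `e_X` as an element of `A_ℓ`, `ℓ = |X|`. -/
def gradedCls (β : α → α → Kˣ) (M : Matroid α) (χ : Finset α → K) {ℓ : ℕ} (X : Finset α)
    (hX : X.card = ℓ) : gradedPart β M χ ℓ :=
  ⟨cls β M χ X, Submodule.subset_span ⟨X, hX, rfl⟩⟩

/-- The flag of flats of an ordered set `f = (f 0, …, f (ℓ-1))`; its `k`-th member is the closure
of the last `k + 1` elements. -/
def flag (M : Matroid α) {ℓ : ℕ} (f : Fin ℓ → α) (k : Fin ℓ) : Set α :=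
  M.closure (f '' Set.Ici k.rev)

lemma isOrdIndep_ordering {M : Matroid α} {I : Finset α} (hI : M.Indep (I : Set α)) {ℓ : ℕ}
    (hc : I.card = ℓ) (σ : Equiv.Perm (Fin ℓ)) : IsOrdIndep M (ordering I hc σ) := by
  refine ⟨(I.orderEmbOfFin hc).injective.comp σ.injective, ?_⟩
  rw [ordering, σ.surjective.range_comp, range_orderEmbOfFin]
  exact hI

end ChiAlgebra

end

namespace ChiAlgebra

open Finset
open scoped Matroid

section

set_option linter.unusedSectionVars false

variable {α K : Type*} [LinearOrder α] [Field K] {β : α → α → Kˣ} {M : Matroid α}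
  {χ : Finset α → K} {x y : α}

/-- The product of the inversion signs of an ordered set. -/
def inversionSign (K : Type*) [Field K] {m : ℕ} (f : Fin m → α) : K :=
  ∏ j, ∏ i ∈ Iio j, if f i < f j then (1 : K) else -1

lemma chiOrd_eq {m : ℕ} (f : Fin m → α) :
    chiOrd χ f = inversionSign K f * χ (univ.image f) := rfl

lemma inversionSign_ne_zero {m : ℕ} (f : Fin m → α) : inversionSign K f ≠ 0 := by
  refine prod_ne_zero_iff.2 fun j _ => prod_ne_zero_iff.2 fun i _ => ?_
  split_ifs <;> simp

lemma image_univ_eq_insert_last {m : ℕ} (f : Fin (m + 1) → α) :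
    univ.image f = insert (f (Fin.last m)) (univ.image (Fin.init f)) := by
  ext a
  simp only [mem_image, mem_univ, true_and, mem_insert, Fin.exists_fin_succ', Fin.init]
  rw [or_comm, eq_comm]

lemma last_notMem_image_init {m : ℕ} {f : Fin (m + 1) → α} (hf : Function.Injective f) :
    f (Fin.last m) ∉ univ.image (Fin.init f) := by
  simp only [mem_image, mem_univ, true_and, not_exists, Fin.init]
  exact fun i h => (Fin.castSucc_lt_last i).ne (hf h)

lemma image_init_eq_erase {m : ℕ} {f : Fin (m + 1) → α} (hf : Function.Injective f) :
    univ.image (Fin.init f) = (univ.image f).erase (f (Fin.last m)) := by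
  rw [image_univ_eq_insert_last, erase_insert (last_notMem_image_init hf)]

lemma injective_init {m : ℕ} {f : Fin (m + 1) → α} (hf : Function.Injective f) :
    Function.Injective (Fin.init f) :=
  hf.comp (Fin.castSucc_injective m)

/-- Contracting the last entry of an ordered set does not change the value of `χ`. -/
lemma chiOrd_contractChi_init {m : ℕ} {f : Fin (m + 1) → α} (hf : Function.Injective f) :
    chiOrd (contractChi χ (f (Fin.last m))) (Fin.init f) = chiOrd χ f := by
  have hn := last_notMem_image_init hf
  rw [chiOrd, chiOrd, contractChi_eq χ hn, ← image_univ_eq_insert_last, Fin.prod_univ_castSucc,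
    ← mul_assoc]
  congr 2
  · refine prod_congr rfl fun j _ => ?_
    rw [← Fin.map_castSuccEmb_Iio, prod_map]
    rfl
  · have h3 : (Iio (Fin.last m)) = univ.map Fin.castSuccEmb := by
      ext i; simp [Fin.exists_castSucc_eq]
    rw [h3, prod_map, filter_image, card_image_of_injective _ (injective_init hf), prod_ite,
      prod_const_one, one_mul, prod_const]
    congr 2
    ext i
    have : f i.castSucc ≠ f (Fin.last m) := fun h => (Fin.castSucc_lt_last i).ne (hf h)
    rw [mem_filter, mem_filter, Fin.init, not_lt, ← this.symm.le_iff_lt]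
    rfl

/-! ### Flags -/

lemma flag_zero {m : ℕ} (f : Fin (m + 1) → α) : flag M f 0 = M.closure {f (Fin.last m)} := by
  rw [flag, Fin.rev_zero, ← Fin.top_eq_last, Set.Ici_top, Set.image_singleton]

lemma flag_succ {m : ℕ} (f : Fin (m + 1) → α) (k : Fin m) :
    flag M f k.succ = M.closure (insert (f (Fin.last m)) (Fin.init f '' Set.Ici k.rev)) := by
  rw [flag, Fin.rev_succ]
  congr 1
  ext a
  simp only [Set.mem_image, Set.mem_Ici, Set.mem_insert_iff, Fin.exists_fin_succ', Fin.init,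
    Fin.castSucc_le_castSucc_iff, Fin.le_last, true_and]
  rw [or_comm, eq_comm]

lemma closure_insert_congr (h : M.closure {y} = M.closure {x}) (Z : Set α) :
    M.closure (insert y Z) = M.closure (insert x Z) := by
  rw [Set.insert_eq, Set.insert_eq]
  exact Matroid.closure_union_congr_left h

lemma flag_contract_init {m : ℕ} (f : Fin (m + 1) → α)
    (h : M.closure {f (Fin.last m)} = M.closure {x}) (k : Fin m) :
    flag (M ／ {x}) (Fin.init f) k = flag M f k.succ \ {x} := by
  rw [flag_succ, closure_insert_congr h, flag, Matroid.contract_closure_eq, Set.union_singleton]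

lemma mem_flag (hx : x ∈ M.E) {m : ℕ} (f : Fin (m + 1) → α)
    (h : M.closure {f (Fin.last m)} = M.closure {x}) (k : Fin m) :
    x ∈ flag M f k.succ := by
  rw [flag_succ, closure_insert_congr h]
  exact M.mem_closure_of_mem' (Set.mem_insert _ _) hx

/-- Two ordered sets have the same flag iff their last elements are parallel and their initial
segments have the same flag in the contraction. -/
lemma flag_eq_iff {m : ℕ} (f g : Fin (m + 1) → α) (hx : f (Fin.last m) ∈ M.E) :
    flag M g = flag M f ↔ M.closure {g (Fin.last m)} = M.closure {f (Fin.last m)} ∧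
      flag (M ／ {f (Fin.last m)}) (Fin.init g) = flag (M ／ {f (Fin.last m)}) (Fin.init f) := by
  constructor
  · intro h
    have h0 : M.closure {g (Fin.last m)} = M.closure {f (Fin.last m)} := by
      rw [← flag_zero, ← flag_zero, h]
    refine ⟨h0, ?_⟩
    ext1 k
    rw [flag_contract_init g h0, flag_contract_init f rfl, h]
  · rintro ⟨h0, h⟩
    ext1 k
    induction k using Fin.cases with
    | zero => rw [flag_zero, flag_zero, h0]
    | succ k =>
      have hk := congrFun h k
      rw [flag_contract_init g h0, flag_contract_init f rfl] at hk
      rw [← Set.insert_eq_of_mem (mem_flag hx g h0 k), ← Set.insert_eq_of_mem (mem_flag hx f rfl k),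
        ← Set.insert_sdiff_singleton, hk, Set.insert_sdiff_singleton]

/-- An ordering of an independent set is determined by its flag. -/
lemma eq_of_flag_eq {m : ℕ} {f g : Fin m → α} (hf : IsOrdIndep M f) (hg : IsOrdIndep M g)
    (hr : Set.range f = Set.range g) (h : flag M f = flag M g) : f = g := by
  have key : ∀ {f g : Fin m → α}, IsOrdIndep M g → Set.range f = Set.range g →
      flag M f = flag M g → ∀ i, ∃ j, i ≤ j ∧ g j = f i := by
    intro f g hg hr h i
    obtain ⟨j, hj⟩ : f i ∈ Set.range g := hr ▸ ⟨i, rfl⟩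
    have hmem : g j ∈ M.closure (g '' Set.Ici i) := by
      have hi := congrFun h i.rev
      rw [flag, flag, Fin.rev_rev] at hi
      rw [← hi, hj]
      exact M.mem_closure_of_mem' ⟨i, Set.mem_Ici.2 le_rfl, rfl⟩
        (hj ▸ hg.indep.subset_ground ⟨j, rfl⟩)
    have hsub : g '' Set.Ici i ⊆ Set.range g := Set.image_subset_range _ _
    obtain ⟨k, hk, hkj⟩ : g j ∈ g '' Set.Ici i := by
      rw [← Matroid.Indep.closure_inter_eq_self_of_subset hg.indep hsub]
      exact ⟨hmem, j, rfl⟩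
    exact ⟨j, hg.injective hkj ▸ hk, hj⟩
  ext1 i
  obtain ⟨j, hij, hj⟩ := key hg hr h i
  obtain ⟨k, hjk, hk⟩ := key hf hr.symm h.symm j
  have : k = i := hf.injective (hk.trans hj)
  rw [← hj, le_antisymm hij (this ▸ hjk)]

/-! ### Iterated residues of monomials -/

lemma residue_of_par (hχ : IsChi β M χ) (hx : M.IsNonloop x) {J : Finset α}
    (hJ : M.Indep (J : Set α)) (hy : Par M x y) (hyJ : y ∈ J) :
    residue β M χ x hχ hx (cls β M χ J) =
      (contractChi χ x (J.erase y) / contractChi χ y (J.erase y)) •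
        cls β (M ／ {x}) (contractChi χ x) (J.erase y) := by
  simp [residue, cls, rawResidue_mon, residueMon_of_par hχ hx hJ hy hyJ]

lemma residue_of_forall_not_par (hχ : IsChi β M χ) (hx : M.IsNonloop x) {J : Finset α}
    (h : ∀ y ∈ J, ¬ Par M x y) : residue β M χ x hχ hx (cls β M χ J) = 0 := by
  simp [residue, cls, rawResidue_mon, residueMon_of_not_par hx h]

lemma Par.indep_erase (hx : M.IsNonloop x) (hy : Par M x y) {J : Finset α}
    (hJ : M.Indep (J : Set α)) (hyJ : y ∈ J) :
    x ∉ J.erase y ∧ (M ／ {x}).Indep (J.erase y : Set α) := by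
  have hxJ : x ∉ J.erase y := by
    intro hxJ
    obtain ⟨hne, hxJ⟩ := mem_erase.1 hxJ
    refine ((par_iff hx hne).1 hy).not_indep (hJ.subset ?_)
    rintro w (rfl | rfl) <;> assumption
  refine ⟨hxJ, ?_⟩
  rw [contract_indep_iff hx hxJ, ← hy.indep_insert_iff hx hxJ (notMem_erase _ _), insert_erase hyJ]
  exact hJ

lemma contractChi_ne_zero (hχ : IsChi β M χ) {X : Finset α} (hx : x ∉ X)
    (hX : M.Indep (insert x X : Finset α)) : contractChi χ x X ≠ 0 := by
  rw [contractChi_eq χ hx]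
  exact mul_ne_zero (pow_ne_zero _ (by simp)) ((hχ.ne_zero_iff _ hX.subset_ground).2 hX)

/-- If the chain of residues along `f` does not vanish on `e_J`, then `J` can be ordered so that it
has the same flag as `f`. -/
theorem exists_flag_eq_of_residueChain_ne_zero {m : ℕ} {M : Matroid α} {χ : Finset α → K}
    (hχ : IsChi β M χ) {f : Fin m → α} (hf : IsOrdIndep M f) {J : Finset α}
    (hJ : M.Indep (J : Set α)) (hJc : J.card = m)
    (h : residueChain β M χ hχ f hf (cls β M χ J) ≠ 0) :
    ∃ g : Fin m → α, Function.Injective g ∧ univ.image g = J ∧ flag M g = flag M f := by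
  induction m generalizing M χ J with
  | zero =>
    rw [card_eq_zero] at hJc
    subst hJc
    exact ⟨f, hf.injective, by simp, rfl⟩
  | succ m ih =>
    have hx := hf.isNonloop
    rw [residueChain, LinearMap.comp_apply] at h
    by_cases hA : ∃ y ∈ J, Par M (f (Fin.last m)) y
    swap
    · push Not at hA
      rw [residue_of_forall_not_par hχ hx hA, map_zero] at h
      exact absurd rfl h
    obtain ⟨y, hyJ, hy⟩ := hA
    rw [residue_of_par hχ hx hJ hy hyJ, map_smul, smul_eq_mul] at h
    obtain ⟨g, hg, hgJ, hgf⟩ := ih (hχ.contract hx) hf.init (hy.indep_erase hx hJ hyJ).2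
      (by rw [card_erase_of_mem hyJ, hJc]; rfl) (right_ne_zero_of_mul h)
    have hyg : y ∉ Set.range g := by
      have : y ∉ univ.image g := hgJ ▸ notMem_erase y J
      simpa using this
    refine ⟨Fin.snoc g y, Fin.snoc_injective_iff.2 ⟨hg, hyg⟩, ?_, ?_⟩
    · rw [image_univ_eq_insert_last, Fin.init_snoc, hgJ, Fin.snoc_last, insert_erase hyJ]
    · rw [flag_eq_iff f _ hx.mem_ground, Fin.snoc_last, Fin.init_snoc]
      exact ⟨hy.2, hgf⟩

/-- The value of the chain of residues along `f` on `e_J`, if `g` is an ordering of `J` with the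
same flag as `f`. -/
theorem residueChain_cls_of_flag_eq {m : ℕ} {M : Matroid α} {χ : Finset α → K}
    (hχ : IsChi β M χ) {f g : Fin m → α} (hf : IsOrdIndep M f) (hg : Function.Injective g)
    {J : Finset α} (hJ : M.Indep (J : Set α)) (hgJ : univ.image g = J)
    (h : flag M g = flag M f) :
    residueChain β M χ hχ f hf (cls β M χ J) = chiOrd χ f / chiOrd χ g := by
  induction m generalizing M χ J with
  | zero =>
    obtain rfl : f = g := Subsingleton.elim _ _
    obtain rfl : J = ∅ := by simp [← hgJ]
    have : chiOrd χ f ≠ 0 := by simpa [chiOrd] using hχ.empty_ne_zero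
    rw [residueChain, degZero_cls_empty hχ, div_self this]
  | succ m ih =>
    have hx := hf.isNonloop
    obtain ⟨h0, h⟩ := (flag_eq_iff f g hx.mem_ground).1 h
    have hyJ : g (Fin.last m) ∈ J := hgJ ▸ mem_image_of_mem g (mem_univ _)
    have hy : Par M (f (Fin.last m)) (g (Fin.last m)) := ⟨hJ.isNonloop_of_mem hyJ, h0⟩
    have hi : univ.image (Fin.init g) = J.erase (g (Fin.last m)) := by
      rw [image_init_eq_erase hg, hgJ]
    obtain ⟨hxJ, hJ'⟩ := hy.indep_erase hx hJ hyJ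
    have hn1 := contractChi_ne_zero hχ hxJ ((contract_indep_iff hx hxJ).1 hJ')
    have hn2 := contractChi_ne_zero hχ (notMem_erase (g (Fin.last m)) J)
      (by rwa [insert_erase hyJ])
    rw [residueChain, LinearMap.comp_apply, residue_of_par hχ hx hJ hy hyJ, map_smul, smul_eq_mul,
      ih (hχ.contract hx) hf.init (injective_init hg) hJ' hi h,
      chiOrd_contractChi_init hf.injective, ← chiOrd_contractChi_init (χ := χ) hg,
      chiOrd_eq (Fin.init g), chiOrd_eq (Fin.init g), hi]
    have hs := inversionSign_ne_zero (K := K) (Fin.init g)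
    field_simp

/-! ### Orderings of finite sets -/

lemma chiOrd_ne_zero (hχ : IsChi β M χ) {m : ℕ} {f : Fin m → α} (hf : IsOrdIndep M f) :
    chiOrd χ f ≠ 0 := by
  have hi : M.Indep ((univ.image f : Finset α) : Set α) := by simpa using hf.indep
  exact mul_ne_zero (inversionSign_ne_zero f) ((hχ.ne_zero_iff _ hi.subset_ground).2 hi)

lemma range_ordering (X : Finset α) {m : ℕ} (hX : X.card = m) (σ : Equiv.Perm (Fin m)) :
    Set.range (ordering X hX σ) = X := by
  rw [ordering, σ.surjective.range_comp, range_orderEmbOfFin]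

lemma image_ordering (X : Finset α) {m : ℕ} (hX : X.card = m) (σ : Equiv.Perm (Fin m)) :
    univ.image (ordering X hX σ) = X := by
  rw [← coe_inj, coe_image, coe_univ, Set.image_univ, range_ordering]

lemma ordering_injective (X : Finset α) {m : ℕ} (hX : X.card = m) :
    Function.Injective (ordering X hX) := fun σ τ h => by
  ext1 i
  exact (X.orderEmbOfFin hX).injective (congrFun h i)

lemma exists_ordering_eq {X : Finset α} {m : ℕ} (hX : X.card = m) {g : Fin m → α}
    (hg : Function.Injective g) (hgX : univ.image g = X) :
    ∃ τ : Equiv.Perm (Fin m), ordering X hX τ = g := by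
  have hmem : ∀ i, ∃ j, X.orderEmbOfFin hX j = g i := fun i => by
    rw [← Set.mem_range, range_orderEmbOfFin, mem_coe, ← hgX]
    exact mem_image_of_mem g (mem_univ i)
  choose t ht using hmem
  have ht' : Function.Injective t := fun i j hij => hg (by rw [← ht, ← ht, hij])
  exact ⟨Equiv.ofBijective t (Finite.injective_iff_bijective.1 ht'), funext ht⟩

end

end ChiAlgebra

theorem mainTheorem7 {n : ℕ} {K : Type*} [Field K] (β : Fin n → Fin n → Kˣ)
    (M : Matroid (Fin n)) (hE : M.E = Set.univ) (χ : Finset (Fin n) → K)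
    (hχ : ChiAlgebra.IsChi β M χ) {ℓ : ℕ} (I : Finset (Fin n)) (hI : M.Indep (I : Set (Fin n)))
    (hIc : I.card = ℓ) (σ : Equiv.Perm (Fin ℓ)) :
    (∀ (J : Finset (Fin n)) (_ : M.Indep (J : Set (Fin n))) (hJc : J.card = ℓ),
      (ChiAlgebra.iteratedResidue β M χ hχ (ChiAlgebra.ordering I hIc σ)
            (ChiAlgebra.isOrdIndep_ordering hI hIc σ) (ChiAlgebra.gradedCls β M χ J hJc) ≠ 0 ↔
        ∃! τ : Equiv.Perm (Fin ℓ), ChiAlgebra.flag M (ChiAlgebra.ordering J hJc τ) =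
          ChiAlgebra.flag M (ChiAlgebra.ordering I hIc σ)) ∧
      ∀ τ : Equiv.Perm (Fin ℓ), ChiAlgebra.flag M (ChiAlgebra.ordering J hJc τ) =
          ChiAlgebra.flag M (ChiAlgebra.ordering I hIc σ) →
        ChiAlgebra.iteratedResidue β M χ hχ (ChiAlgebra.ordering I hIc σ)
            (ChiAlgebra.isOrdIndep_ordering hI hIc σ) (ChiAlgebra.gradedCls β M χ J hJc) =
          ChiAlgebra.chiOrd χ (ChiAlgebra.ordering I hIc σ) /
            ChiAlgebra.chiOrd χ (ChiAlgebra.ordering J hJc τ)) ∧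
    ChiAlgebra.iteratedResidue β M χ hχ (ChiAlgebra.ordering I hIc σ)
      (ChiAlgebra.isOrdIndep_ordering hI hIc σ) (ChiAlgebra.gradedCls β M χ I hIc) = 1 := by
  have hval : ∀ (J : Finset (Fin n)) (hJ : M.Indep (J : Set (Fin n))) (hJc : J.card = ℓ)
      (τ : Equiv.Perm (Fin ℓ)), ChiAlgebra.flag M (ChiAlgebra.ordering J hJc τ) =
          ChiAlgebra.flag M (ChiAlgebra.ordering I hIc σ) →
        ChiAlgebra.iteratedResidue β M χ hχ (ChiAlgebra.ordering I hIc σ)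
            (ChiAlgebra.isOrdIndep_ordering hI hIc σ) (ChiAlgebra.gradedCls β M χ J hJc) =
          ChiAlgebra.chiOrd χ (ChiAlgebra.ordering I hIc σ) /
            ChiAlgebra.chiOrd χ (ChiAlgebra.ordering J hJc τ) := fun J hJ hJc τ h =>
    ChiAlgebra.residueChain_cls_of_flag_eq hχ _
      (ChiAlgebra.isOrdIndep_ordering hJ hJc τ).injective hJ (ChiAlgebra.image_ordering J hJc τ) h
  have hne : ∀ (J : Finset (Fin n)) (_ : M.Indep (J : Set (Fin n))) (hJc : J.card = ℓ)
      (τ : Equiv.Perm (Fin ℓ)), ChiAlgebra.chiOrd χ (ChiAlgebra.ordering J hJc τ) ≠ 0 :=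
    fun J hJ hJc τ => ChiAlgebra.chiOrd_ne_zero hχ (ChiAlgebra.isOrdIndep_ordering hJ hJc τ)
  refine ⟨fun J hJ hJc => ⟨⟨fun h => ?_, ?_⟩, hval J hJ hJc⟩, ?_⟩
  · obtain ⟨g, hg, hgJ, hgf⟩ := ChiAlgebra.exists_flag_eq_of_residueChain_ne_zero hχ _ hJ hJc h
    obtain ⟨τ, rfl⟩ := ChiAlgebra.exists_ordering_eq hJc hg hgJ
    refine ⟨τ, hgf, fun τ' hτ' => ChiAlgebra.ordering_injective J hJc ?_⟩
    exact ChiAlgebra.eq_of_flag_eq (ChiAlgebra.isOrdIndep_ordering hJ hJc τ')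
      (ChiAlgebra.isOrdIndep_ordering hJ hJc τ) (by simp only [ChiAlgebra.range_ordering])
      (hτ'.trans hgf.symm)
  · rintro ⟨τ, hτ, -⟩
    rw [hval J hJ hJc τ hτ]
    exact div_ne_zero (hne I hI hIc σ) (hne J hJ hJc τ)
  · rw [hval I hI hIc σ rfl, div_self (hne I hI hIc σ)]
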